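/- Setting. Let $\chi$ be a finite set of at least two decisions, $d\ge 1$, and $Y\subset\mathbb R^d$ bounded with interior $Y^\circ$. For each $x\in\chi$ let $f_x:Y\to\mathbb R$ be uniformly bounded and Lipschitz with constant $L_1>0$, and let $\sigma_x:Y\to(0,\infty)$ be Lipschitz with constant $L_2>0$. Observations $\gamma_{[i]}=((x_{[i]},y_{[i]}),\tilde G_{[i]})$, $i=1,2,\dots$, are generated sequentially, with $\mathcal D^{(t)}=(\gamma_{[1]},\dots,\gamma_{[t]})$: given $\mathcal D^{(t-1)}$, the pair $(x_{[t]},y_{[t]})\in\chi\times Y^\circ$ has density $a^{(t)}(x,y)$ (with respect to counting measure times Lebesgue measure), which may depend on $\mathcal D^{(t-1)}$; then, given also $(x_{[t]},y_{[t]})=(x,y)$, $\tilde G_{[t]}=f_x(y)+\epsilon_{[t]}$ with $\epsilon_{[t]}\sim N(0,\sigma_x(y)^2)$ (standard deviation $\sigma_x(y)$), independently of the past. Suppose that there is a constant $\lambda_L>0$ such that $a^{(t)}(x,y)>\lambda_L$ for all $t$, all $x\in\chi$ and all $y\in Y^\circ$. Estimator. Fix $c,\xi>0$ and put $r_m=c\,m^{-\xi/d}$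 for $m\ge 1$. The $m$-set at $(x,y)$ on stage $t$ is $b^{(t)}_m(x,y)=\{i\le t: x_{[i]}=x,\ \|y_{[i]}-y\|<r_m,\ y_{[i]}\in Y^\circ\}$ (Euclidean norm); it is activated if it has at least $m$ elements. Let $\Psi=\Psi^{(t)}_{x,y}$ be the largest $m$ whose $m$-set is activated on stage $t$, let $\tau\le t$ be the first stage at which $|b^{(\tau)}_\Psi(x,y)|=\Psi$, and let $\hat f^{(t)}_x(y)=\frac1\Psi\sum_{i\in b_\Psi^{(\tau)}(x,y)}\tilde G_{[i]}$. Let $\hat x^{(t)}(y)$ be a minimizer of $x\mapsto\hat f_x^{(t)}(y)$, with ties broken in any (possibly random) way, and with an arbitrary choice as long as some $\hat f_x^{(t)}(y)$ is undefined because no $m$-set is activated. Given a metric $\mathsf d$ on $\mathbb R$, and a context $y$ with a unique optimal decision $x^*=\arg\min_x f_x(y)$, the conditional decision loss is $\upsilon^{(t)}(y)=E\,\mathsf d\big(f_{\hat x^{(t)}(y)}(y),f_{x^*}(y)\big)$. Theorem 2. For every $y\in Y^\circ$ with a unique optimal decision $x^*$, $\upsilon^{(t)}(y)\to 0$ as $t\to\infty$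 and, with the convention $\ln 0=-\infty$, $$\liminf_{t\to\infty}\ -\frac{1}{t^{1/(1+\xi)}}\ln\upsilon^{(t)}(y)\ \ge\ H_y>0,$$ where $$H_y=(C\lambda_L)^{\frac1{1+\xi}}\,\zeta(y)\,\big(-W_{-1}(-e^{-\zeta(y)-1})\big)^{-\frac1{1+\xi}},\qquad C=\frac{\pi^{d/2}}{\Gamma(\frac d2+1)}\,c^d,$$ $$\zeta(y)=\min_{x\ne x^*}\frac{(f_x(y)-f_{x^*}(y))^2}{2(\sigma_{x^*}(y)^2+\sigma_x(y)^2)},$$ and $W_{-1}$ is the lower branch of the Lambert function: for $z\in[-e^{-1},0)$, $W_{-1}(z)$ is the unique $w\le -1$ with $we^w=z$. -/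

import Mathlib

open MeasureTheory ProbabilityTheory Filter Topology
open scoped ENNReal NNReal

noncomputable section

/-- One simulation observation `((x, y), G)`: the decision, the context, the noisy output. -/
abbrev Obs (χ : Type*) (d : ℕ) : Type _ := (χ × EuclideanSpace ℝ (Fin d)) × ℝ

/-- The dataset formed by the first `t` observations of a sequence of observations. -/
def dataset {χ : Type*} {d : ℕ} (s : ℕ → Obs χ d) (t : ℕ) : Fin t → Obs χ d :=
  fun i => s i

/-- The set of minimizers of `u`. -/
def argminSet {χ : Type*} (u : χ → ℝ) : Set χ := {x | ∀ x', u x ≤ u x'}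

/-- `dm` is a metric on the real line. -/
structure IsMetricFun (dm : ℝ → ℝ → ℝ) : Prop where
  eq_zero_iff : ∀ u v, dm u v = 0 ↔ u = v
  symm : ∀ u v, dm u v = dm v u
  triangle : ∀ u v w, dm u w ≤ dm u v + dm v w

/-- Indices of the runs among the first `t` that use the decision `x` and a context in the
interior of `Y` at distance less than `r` from `y`. -/
def localSet {χ : Type*} {d : ℕ} (Y : Set (EuclideanSpace ℝ (Fin d)))
    (s : ℕ → Obs χ d) (t : ℕ) (x : χ) (y : EuclideanSpace ℝ (Fin d)) (r : ℝ) : Finset ℕ :=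
  open Classical in
  (Finset.range t).filter fun i =>
    (s i).1.1 = x ∧ ‖(s i).1.2 - y‖ < r ∧ (s i).1.2 ∈ interior Y

/-- The radii `r_m = c m ^ (-ξ / d)`, for `m = 1, 2, …`. -/
def radius (d : ℕ) (c ξ : ℝ) (m : ℕ) : ℝ := c * (m : ℝ) ^ (-ξ / (d : ℝ))

/-- The `m`-set at `(x, y)` on stage `t`. -/
def mSet {χ : Type*} {d : ℕ} (Y : Set (EuclideanSpace ℝ (Fin d))) (c ξ : ℝ)
    (s : ℕ → Obs χ d) (t m : ℕ) (x : χ) (y : EuclideanSpace ℝ (Fin d)) : Finset ℕ :=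
  localSet Y s t x y (radius d c ξ m)

/-- The largest `m ≥ 1` whose `m`-set is activated, that is, has at least `m` elements, on
stage `t` (such an `m` is at most `t`). The value is `0` if no `m`-set is activated. -/
def nbhdSize {χ : Type*} {d : ℕ} (Y : Set (EuclideanSpace ℝ (Fin d))) (c ξ : ℝ)
    (s : ℕ → Obs χ d) (t : ℕ) (x : χ) (y : EuclideanSpace ℝ (Fin d)) : ℕ :=
  open Classical in
  Nat.findGreatest (fun m => m ≤ (mSet Y c ξ s t m x y).card) t

/-- The first stage at which the `m`-set at `(x, y)` has exactly `m` elements. -/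
def activationTime {χ : Type*} {d : ℕ} (Y : Set (EuclideanSpace ℝ (Fin d))) (c ξ : ℝ)
    (s : ℕ → Obs χ d) (m : ℕ) (x : χ) (y : EuclideanSpace ℝ (Fin d)) : ℕ :=
  sInf {t' | (mSet Y c ξ s t' m x y).card = m}

/-- The neighborhood sample at `(x, y)` on stage `t`: the activated `m`-set with the largest
`m`, frozen at the stage at which it became activated. -/
def nbhd {χ : Type*} {d : ℕ} (Y : Set (EuclideanSpace ℝ (Fin d))) (c ξ : ℝ)
    (s : ℕ → Obs χ d) (t : ℕ) (x : χ) (y : EuclideanSpace ℝ (Fin d)) : Finset ℕ :=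
  mSet Y c ξ s (activationTime Y c ξ s (nbhdSize Y c ξ s t x y) x y)
    (nbhdSize Y c ξ s t x y) x y

/-- The shrinking neighborhood estimator: the sample average over the neighborhood sample.
It is meaningful if `1 ≤ nbhdSize`. -/
def sneEstimator {χ : Type*} {d : ℕ} (Y : Set (EuclideanSpace ℝ (Fin d))) (c ξ : ℝ)
    (s : ℕ → Obs χ d) (t : ℕ) (x : χ) (y : EuclideanSpace ℝ (Fin d)) : ℝ :=
  (1 / (nbhdSize Y c ξ s t x y : ℝ)) * ∑ i ∈ nbhd Y c ξ s t x y, (s i).2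

/-- A dynamic random sampling rule: given the dataset `D` of the first `t` observations,
`a t D` is the density, with respect to counting measure on `χ` times Lebesgue measure on the
interior of `Y`, of the next decision-context pair. -/
structure IsSamplingRule {χ : Type*} [Fintype χ] [MeasurableSpace χ] {d : ℕ}
    (Y : Set (EuclideanSpace ℝ (Fin d)))
    (a : (t : ℕ) → (Fin t → Obs χ d) → χ → EuclideanSpace ℝ (Fin d) → ℝ) : Prop where
  measurable : ∀ t, Measurable
    fun p : (Fin t → Obs χ d) × (χ × EuclideanSpace ℝ (Fin d)) => a t p.1 p.2.1 p.2.2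
  nonneg : ∀ t D x, ∀ y ∈ interior Y, 0 ≤ a t D x y
  total : ∀ t D, ∑ x, ∫⁻ y in interior Y, ENNReal.ofReal (a t D x y) = 1

/-- `γ` is a sequence of observations generated by the sampling rule `a` and the simulator with
mean performance `f` and independent centred Gaussian noise of standard deviation `σ`:
given the first `t` observations, the next decision-context pair has density `a t D`, and, given
these observations and that pair `(x, y)`, the output is `f x y + e` with `e` of law
`N(0, σ x y ^ 2)`. The conditional law is expressed by integrating an arbitrary nonnegative
test function. -/
structure IsSequentialSampling {χ : Type*} [Fintype χ] [MeasurableSpace χ] {d : ℕ}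
    (Y : Set (EuclideanSpace ℝ (Fin d))) (f σ : χ → EuclideanSpace ℝ (Fin d) → ℝ)
    (a : (t : ℕ) → (Fin t → Obs χ d) → χ → EuclideanSpace ℝ (Fin d) → ℝ)
    {Ω : Type*} [MeasurableSpace Ω] (P : Measure Ω) (γ : ℕ → Ω → Obs χ d) : Prop where
  measurable : ∀ i, Measurable (γ i)
  law : ∀ (t : ℕ) (g : (Fin t → Obs χ d) × Obs χ d → ℝ≥0∞), Measurable g →
    ∫⁻ ω, g (dataset (fun i => γ i ω) t, γ t ω) ∂P =
      ∫⁻ ω, (∑ x, ∫⁻ y in interior Y,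
        (ENNReal.ofReal (a t (dataset (fun i => γ i ω) t) x y) *
          (∫⁻ e, g (dataset (fun i => γ i ω) t, ((x, y), f x y + e))
            ∂(gaussianReal 0 (Real.toNNReal (σ x y ^ 2)))))) ∂P

/-- `xhat t` is the decision inferred at the context `y` on stage `t`: a minimizer of the
estimates whenever all of them are defined. Ties are broken in an arbitrary, possibly random,
way, and the decision is arbitrary as long as some estimate is undefined. -/
structure IsInferredDecision {χ : Type*} [MeasurableSpace χ] {d : ℕ}
    (Y : Set (EuclideanSpace ℝ (Fin d))) (c ξ : ℝ) {Ω : Type*} [MeasurableSpace Ω]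
    (γ : ℕ → Ω → Obs χ d) (y : EuclideanSpace ℝ (Fin d)) (xhat : ℕ → Ω → χ) : Prop where
  measurable : ∀ t, Measurable (xhat t)
  mem_argmin : ∀ t ω, (∀ x, 1 ≤ nbhdSize Y c ξ (fun i => γ i ω) t x y) →
    xhat t ω ∈ argminSet fun x => sneEstimator Y c ξ (fun i => γ i ω) t x y

/-- The conditional decision loss at `y`: the expectation of `dm (f (xhat y) y) (f (x* y) y)`. -/
def condLoss {χ : Type*} {d : ℕ} (f : χ → EuclideanSpace ℝ (Fin d) → ℝ) (dm : ℝ → ℝ → ℝ)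
    {Ω : Type*} [MeasurableSpace Ω] (P : Measure Ω) (y : EuclideanSpace ℝ (Fin d))
    (xs : χ) (xhat : Ω → χ) : ℝ≥0∞ :=
  ∫⁻ ω, ENNReal.ofReal (dm (f (xhat ω) y) (f xs y)) ∂P

/-- The lower branch of the Lambert function: for `z ∈ [-1/e, 0)`, the unique `w ≤ -1` with
`w * exp w = z`. -/
def lambertWLower (z : ℝ) : ℝ := sInf {w : ℝ | w ≤ -1 ∧ w * Real.exp w = z}

/-- The volume constant `C = π ^ (d / 2) / Γ(d / 2 + 1) * c ^ d`. -/
def ballConst (d : ℕ) (c : ℝ) : ℝ :=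
  Real.pi ^ ((d : ℝ) / 2) / Real.Gamma ((d : ℝ) / 2 + 1) * c ^ d

/-- The least, over the decisions `x` other than `xs`, of
`(f x y - f xs y) ^ 2 / (2 * (σ xs y ^ 2 + σ x y ^ 2))`. -/
def zeta {χ : Type*} {d : ℕ} (f σ : χ → EuclideanSpace ℝ (Fin d) → ℝ)
    (y : EuclideanSpace ℝ (Fin d)) (xs : χ) : ℝ :=
  ⨅ x : {x : χ // x ≠ xs}, (f x y - f xs y) ^ 2 / (2 * (σ xs y ^ 2 + σ x y ^ 2))

/-- The rate `H_y`. -/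
def rateH {χ : Type*} {d : ℕ} (f σ : χ → EuclideanSpace ℝ (Fin d) → ℝ) (c ξ lamL : ℝ)
    (y : EuclideanSpace ℝ (Fin d)) (xs : χ) : ℝ :=
  (ballConst d c * lamL) ^ (1 / (1 + ξ)) * zeta f σ y xs *
    (-lambertWLower (-Real.exp (-zeta f σ y xs - 1))) ^ (-(1 / (1 + ξ)))

end

/-!
Put `s = -W₋₁(-e^(-ζ-1))`, so that `s ≥ 1` and `s - 1 - log s = ζ`, and consider on stage `t` the
single level `μ = ⌊(C λ t / s) ^ (1 / (1 + ξ))⌋`. The neighbourhood of the `μ`-set has volume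
`C μ ^ (-ξ)`, so the expected number of its hits is at least `s μ`, and a wrong decision has two
possible causes.

* Some decision has fewer than `μ` hits, so that its `μ`-set is not activated. Every stage hits with
  conditional probability at least `C λ μ ^ (-ξ)` whatever the past, and the Chernoff bound
  (`IsSequentialSampling.measure_card_localSet_le`) makes this event as unlikely as
  `exp (-(s - 1 - log s) μ) = exp (-ζ μ)`.
* All frozen samples have at least `μ` elements, but a suboptimal decision has an estimate no larger
  than the optimal one. For fixed sizes of the two samples the frozen samples are the first hits of
  fixed neighbourhoods, so that an exponential supermartingale with Gaussian increments bounds the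
  probability (`IsSequentialSampling.measure_sneEstimator_le`) by `exp (-z μ)`, for any `z < ζ` once
  the neighbourhoods are small. A union over the at most `(t + 1) ^ 2` pairs of sizes costs only a
  polynomial factor.

Both exponents are `ζ μ` to first order, which is `H_y t ^ (1 / (1 + ξ))`; this balance is what
determines `s`. Both bounds come from the same induction on the stage,
`IsSequentialSampling.lintegral_prod_le`: a product of weights, each of conditional expectation at
most `b t` given the past, has expectation at most the product of the `b t`.
-/

/-! ### Products of one-step weights along a sequential sample -/

/-- The product `∏ i < t, u i (D_i, o_i)` of one-step weights along a dataset, where `o_i` is the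
`i`-th observation of `D` and `D_i` is the dataset of the observations before it. -/
noncomputable def weightProd {χ : Type*} {d : ℕ}
    (u : (t : ℕ) → (Fin t → Obs χ d) × Obs χ d → ℝ≥0∞) (t : ℕ) (D : Fin t → Obs χ d) : ℝ≥0∞ :=
  ∏ i : Fin t, u i (fun j => D (j.castLE i.2.le), D i)

lemma weightProd_dataset {χ : Type*} {d : ℕ}
    (u : (t : ℕ) → (Fin t → Obs χ d) × Obs χ d → ℝ≥0∞) (t : ℕ) (s : ℕ → Obs χ d) :
    weightProd u t (dataset s t) = ∏ i ∈ Finset.range t, u i (dataset s i, s i) := by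
  rw [Finset.prod_range]
  rfl

lemma measurable_weightProd {χ : Type*} [MeasurableSpace χ] {d : ℕ}
    {u : (t : ℕ) → (Fin t → Obs χ d) × Obs χ d → ℝ≥0∞} (hu : ∀ t, Measurable (u t)) (t : ℕ) :
    Measurable (weightProd u t) := by
  unfold weightProd
  refine Finset.measurable_prod _ fun i _ => (hu i).comp ?_
  fun_prop

lemma measurable_dataset {χ : Type*} [MeasurableSpace χ] {d : ℕ} {Ω : Type*} [MeasurableSpace Ω]
    {γ : ℕ → Ω → Obs χ d} (hγ : ∀ i, Measurable (γ i)) (t : ℕ) :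
    Measurable fun ω => dataset (fun i => γ i ω) t :=
  measurable_pi_lambda _ fun i => hγ i

/-- If, given any dataset, the conditional expectation of the weight `u t` is at most `b t`, then
the expected product of the first `T` weights is at most `∏ t < T, b t`. This replaces the use of
supermartingales. -/
lemma IsSequentialSampling.lintegral_prod_le {χ : Type*} [Fintype χ] [MeasurableSpace χ] {d : ℕ}
    {Y : Set (EuclideanSpace ℝ (Fin d))} {f σ : χ → EuclideanSpace ℝ (Fin d) → ℝ}
    {a : (t : ℕ) → (Fin t → Obs χ d) → χ → EuclideanSpace ℝ (Fin d) → ℝ}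
    {Ω : Type*} [MeasurableSpace Ω] {P : Measure Ω} [IsProbabilityMeasure P]
    {γ : ℕ → Ω → Obs χ d} (hγ : IsSequentialSampling Y f σ a P γ)
    (u : (t : ℕ) → (Fin t → Obs χ d) × Obs χ d → ℝ≥0∞) (hu : ∀ t, Measurable (u t))
    (hu_top : ∀ t p, u t p ≠ ∞) (b : ℕ → ℝ≥0∞)
    (hb : ∀ t D, ∑ x, ∫⁻ y in interior Y, (ENNReal.ofReal (a t D x y) *
      ∫⁻ e, u t (D, ((x, y), f x y + e)) ∂(gaussianReal 0 (Real.toNNReal (σ x y ^ 2)))) ≤ b t)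
    (T : ℕ) :
    ∫⁻ ω, ∏ i ∈ Finset.range T, u i (dataset (fun j => γ j ω) i, γ i ω) ∂P ≤
      ∏ i ∈ Finset.range T, b i := by
  induction T with
  | zero => simp
  | succ T ih =>
    have hV := measurable_weightProd hu T
    have hV_top : ∀ D, weightProd u T D ≠ ∞ := fun D =>
      ENNReal.prod_ne_top fun i _ => hu_top _ _
    calc ∫⁻ ω, ∏ i ∈ Finset.range (T + 1), u i (dataset (fun j => γ j ω) i, γ i ω) ∂P
        = ∫⁻ ω, (fun p : (Fin T → Obs χ d) × Obs χ d => weightProd u T p.1 * u T p)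
            (dataset (fun i => γ i ω) T, γ T ω) ∂P := by
          refine lintegral_congr fun ω => ?_
          simp only [Finset.prod_range_succ, weightProd_dataset]
      _ = ∫⁻ ω, weightProd u T (dataset (fun i => γ i ω) T) *
            (∑ x, ∫⁻ y in interior Y, (ENNReal.ofReal (a T (dataset (fun i => γ i ω) T) x y) *
              ∫⁻ e, u T (dataset (fun i => γ i ω) T, ((x, y), f x y + e))
                ∂(gaussianReal 0 (Real.toNNReal (σ x y ^ 2))))) ∂P := by
          rw [hγ.law T (fun p => weightProd u T p.1 * u T p) ((hV.comp measurable_fst).mul (hu T))]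
          refine lintegral_congr fun ω => ?_
          rw [Finset.mul_sum]
          refine Finset.sum_congr rfl fun x _ => ?_
          rw [← lintegral_const_mul' _ _ (hV_top _)]
          refine lintegral_congr fun y => ?_
          rw [lintegral_const_mul' _ _ (hV_top _), mul_left_comm]
      _ ≤ ∫⁻ ω, weightProd u T (dataset (fun i => γ i ω) T) * b T ∂P := by
          gcongr with ω
          exact hb _ _
      _ = (∫⁻ ω, weightProd u T (dataset (fun i => γ i ω) T) ∂P) * b T :=
          lintegral_mul_const _ (hV.comp (measurable_dataset hγ.measurable T))
      _ ≤ ∏ i ∈ Finset.range (T + 1), b i := by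
          rw [Finset.prod_range_succ]
          simp only [weightProd_dataset]
          gcongr

/-! ### Hits of a neighbourhood and the frozen neighbourhood sample -/

/-- The observations that use the decision `x` and a context in the interior of `Y` at distance
less than `r` from `y`. -/
def hitSet {χ : Type*} {d : ℕ} (Y : Set (EuclideanSpace ℝ (Fin d))) (x : χ)
    (y : EuclideanSpace ℝ (Fin d)) (r : ℝ) : Set (Obs χ d) :=
  {o | o.1.1 = x ∧ ‖o.1.2 - y‖ < r ∧ o.1.2 ∈ interior Y}

lemma measurableSet_hitSet {χ : Type*} [MeasurableSpace χ] [MeasurableSingletonClass χ] {d : ℕ}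
    (Y : Set (EuclideanSpace ℝ (Fin d))) (x : χ) (y : EuclideanSpace ℝ (Fin d)) (r : ℝ) :
    MeasurableSet (hitSet Y x y r) := by
  have h1 : Measurable fun o : Obs χ d => o.1.1 := by fun_prop
  have h2 : Measurable fun o : Obs χ d => o.1.2 := by fun_prop
  exact (h1 (measurableSet_singleton x)).inter
    ((measurableSet_lt (h2.sub_const y).norm measurable_const).inter
      (h2 isOpen_interior.measurableSet))

/-- The number of observations of a dataset that lie in `H`. -/
noncomputable def hitCount {χ : Type*} {d : ℕ} (H : Set (Obs χ d)) {t : ℕ}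
    (D : Fin t → Obs χ d) : ℕ :=
  ∑ i, H.indicator 1 (D i)

lemma measurable_hitCount {χ : Type*} [MeasurableSpace χ] {d : ℕ} {H : Set (Obs χ d)}
    (hH : MeasurableSet H) (t : ℕ) : Measurable fun D : Fin t → Obs χ d => hitCount H D := by
  unfold hitCount
  refine Finset.measurable_sum _ fun i _ => ?_
  exact (measurable_one.indicator hH).comp (measurable_pi_apply i)

lemma hitCount_dataset {χ : Type*} {d : ℕ} (Y : Set (EuclideanSpace ℝ (Fin d)))
    (s : ℕ → Obs χ d) (t : ℕ) (x : χ) (y : EuclideanSpace ℝ (Fin d)) (r : ℝ) :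
    hitCount (hitSet Y x y r) (dataset s t) = (localSet Y s t x y r).card := by
  classical
  rw [localSet, Finset.card_filter, Finset.sum_range]
  refine Finset.sum_congr rfl fun i _ => ?_
  simp only [Set.indicator, hitSet, dataset, Set.mem_ofPred_eq, Pi.one_apply]
  congr

lemma mem_localSet {χ : Type*} {d : ℕ} {Y : Set (EuclideanSpace ℝ (Fin d))}
    {s : ℕ → Obs χ d} {t : ℕ} {x : χ} {y : EuclideanSpace ℝ (Fin d)} {r : ℝ} {i : ℕ} :
    i ∈ localSet Y s t x y r ↔ i < t ∧ s i ∈ hitSet Y x y r := by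
  simp [localSet, hitSet]

lemma card_localSet_mono {χ : Type*} {d : ℕ} (Y : Set (EuclideanSpace ℝ (Fin d)))
    (s : ℕ → Obs χ d) (x : χ) (y : EuclideanSpace ℝ (Fin d)) (r : ℝ) :
    Monotone fun t => (localSet Y s t x y r).card := fun t t' h =>
  Finset.card_le_card fun i hi => by
    rw [mem_localSet] at hi ⊢
    exact ⟨hi.1.trans_le h, hi.2⟩

lemma card_localSet_succ_le {χ : Type*} {d : ℕ} (Y : Set (EuclideanSpace ℝ (Fin d)))
    (s : ℕ → Obs χ d) (t : ℕ) (x : χ) (y : EuclideanSpace ℝ (Fin d)) (r : ℝ) :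
    (localSet Y s (t + 1) x y r).card ≤ (localSet Y s t x y r).card + 1 := by
  classical
  refine (Finset.card_le_card (t := insert t (localSet Y s t x y r)) fun i hi => ?_).trans
    (Finset.card_insert_le _ _)
  rw [Finset.mem_insert, mem_localSet]
  rw [mem_localSet] at hi
  rcases Nat.lt_succ_iff_lt_or_eq.1 hi.1 with h | h
  · exact Or.inr ⟨h, hi.2⟩
  · exact Or.inl h

/-- The number of elements of the local set passes through every value up to its present one. -/
lemma exists_card_localSet_eq {χ : Type*} {d : ℕ} (Y : Set (EuclideanSpace ℝ (Fin d)))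
    (s : ℕ → Obs χ d) (x : χ) (y : EuclideanSpace ℝ (Fin d)) (r : ℝ) (m t : ℕ)
    (h : m ≤ (localSet Y s t x y r).card) :
    ∃ t' ≤ t, (localSet Y s t' x y r).card = m := by
  induction t with
  | zero =>
    have h0 : (localSet Y s 0 x y r).card = 0 := by simp [localSet]
    exact ⟨0, le_rfl, by omega⟩
  | succ t ih =>
    by_cases h' : m ≤ (localSet Y s t x y r).card
    · obtain ⟨t', ht', e⟩ := ih h'
      exact ⟨t', ht'.trans t.le_succ, e⟩
    · exact ⟨t + 1, le_rfl, by have := card_localSet_succ_le Y s t x y r; omega⟩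

/-- The weight of an observation that is `h G`, with `G` its output, if it is one of the first `m`
observations in `H`, and `1` otherwise. -/
noncomputable def firstHitsWeight {χ : Type*} {d : ℕ} (H : Set (Obs χ d)) (m : ℕ)
    (h : ℝ → ℝ≥0∞) (t : ℕ) (p : (Fin t → Obs χ d) × Obs χ d) : ℝ≥0∞ :=
  open Classical in if hitCount H p.1 < m ∧ p.2 ∈ H then h p.2.2 else 1

lemma measurable_firstHitsWeight {χ : Type*} [MeasurableSpace χ] {d : ℕ} {H : Set (Obs χ d)}
    (hH : MeasurableSet H) (m : ℕ) {h : ℝ → ℝ≥0∞} (hh : Measurable h) (t : ℕ) :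
    Measurable (firstHitsWeight H m h t) := by
  unfold firstHitsWeight
  refine Measurable.ite ?_ (by fun_prop) measurable_const
  exact (measurableSet_lt ((measurable_hitCount hH t).comp measurable_fst) measurable_const).inter
    (measurable_snd hH)

lemma firstHitsWeight_ne_top {χ : Type*} {d : ℕ} (H : Set (Obs χ d)) (m : ℕ) {h : ℝ → ℝ≥0∞}
    (hh : ∀ u, h u ≠ ∞) (t : ℕ) (p : (Fin t → Obs χ d) × Obs χ d) :
    firstHitsWeight H m h t p ≠ ∞ := by
  unfold firstHitsWeight
  split_ifs
  · exact hh _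
  · exact ENNReal.one_ne_top

section ActivationTime

variable {χ : Type*} {d : ℕ} {Y : Set (EuclideanSpace ℝ (Fin d))} {c ξ : ℝ}
  {s : ℕ → Obs χ d} {t m : ℕ} {x : χ} {y : EuclideanSpace ℝ (Fin d)}

lemma card_mSet_activationTime (h : m ≤ (mSet Y c ξ s t m x y).card) :
    (mSet Y c ξ s (activationTime Y c ξ s m x y) m x y).card = m := by
  obtain ⟨t', -, e⟩ := exists_card_localSet_eq Y s x y (radius d c ξ m) m t h
  exact Nat.sInf_mem (s := {t' | (mSet Y c ξ s t' m x y).card = m}) ⟨t', e⟩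

/-- Once the `m`-set is activated, the frozen sample consists of the first `m` hits of its
neighbourhood, so it carries the whole product of the weights of these hits. -/
lemma prod_firstHitsWeight (h : m ≤ (mSet Y c ξ s t m x y).card) (w : ℝ → ℝ≥0∞) :
    ∏ i ∈ Finset.range t,
        firstHitsWeight (hitSet Y x y (radius d c ξ m)) m w i (dataset s i, s i) =
      ∏ i ∈ mSet Y c ξ s (activationTime Y c ξ s m x y) m x y, w (s i).2 := by
  classical
  have hcard := card_mSet_activationTime h
  obtain ⟨t', ht', e⟩ := exists_card_localSet_eq Y s x y (radius d c ξ m) m t h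
  have hτt : activationTime Y c ξ s m x y ≤ t := 
    (Nat.sInf_le (s := {t' | (mSet Y c ξ s t' m x y).card = m}) e).trans ht'
  have hlt : ∀ i, hitCount (hitSet Y x y (radius d c ξ m)) (dataset s i) < m ↔
      i < activationTime Y c ξ s m x y := by
    intro i
    rw [hitCount_dataset]
    constructor
    · intro hi
      by_contra! hle
      have := card_localSet_mono Y s x y (radius d c ξ m) hle
      simp only [mSet] at hcard
      simp only at this
      omega
    · intro hi
      have h1 := card_localSet_mono Y s x y (radius d c ξ m) hi.le
      have h2 : (localSet Y s i x y (radius d c ξ m)).card ≠ m := fun e =>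
        Nat.notMem_of_lt_sInf hi e
      simp only [mSet] at hcard
      simp only at h1
      omega
  simp only [firstHitsWeight, hlt]
  rw [← Finset.prod_filter]
  refine Finset.prod_congr ?_ fun _ _ => rfl
  ext i
  rw [Finset.mem_filter, Finset.mem_range, mSet, mem_localSet]
  constructor
  · exact fun hi => hi.2
  · exact fun hi => ⟨hi.1.trans_le hτt, hi⟩

lemma nbhdSize_le_card (h : 1 ≤ nbhdSize Y c ξ s t x y) :
    nbhdSize Y c ξ s t x y ≤ (mSet Y c ξ s t (nbhdSize Y c ξ s t x y) x y).card := by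
  classical
  have := Nat.findGreatest_of_ne_zero (P := fun m => m ≤ (mSet Y c ξ s t m x y).card) (n := t)
    (m := nbhdSize Y c ξ s t x y) (by unfold nbhdSize; congr) (by omega)
  exact this

lemma nbhdSize_le : nbhdSize Y c ξ s t x y ≤ t := by
  classical
  exact Nat.findGreatest_le t

lemma le_nbhdSize (h : m ≤ (mSet Y c ξ s t m x y).card) : m ≤ nbhdSize Y c ξ s t x y := by
  classical
  refine Nat.le_findGreatest (h.trans ?_) h
  calc (mSet Y c ξ s t m x y).card ≤ (Finset.range t).card :=
        Finset.card_le_card fun i hi => Finset.mem_range.2 (mem_localSet.1 hi).1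
    _ = t := Finset.card_range t

end ActivationTime

/-! ### Few hits are exponentially unlikely -/

lemma volume_ball_eq_ballConst {d : ℕ} (hd : 0 < d) (y : EuclideanSpace ℝ (Fin d)) {r : ℝ}
    (hr : 0 ≤ r) : volume (Metric.ball y r) = ENNReal.ofReal (ballConst d r) := by
  have : Nonempty (Fin d) := ⟨⟨0, hd⟩⟩
  rw [EuclideanSpace.volume_ball, Fintype.card_fin, ballConst, ← ENNReal.ofReal_pow hr,
    ← ENNReal.ofReal_mul (by positivity), mul_comm]
  congr 3
  rw [Real.sqrt_eq_rpow, ← Real.rpow_natCast, ← Real.rpow_mul Real.pi_pos.le]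
  congr 1
  ring

lemma ballConst_pos (d : ℕ) {c : ℝ} (hc : 0 < c) : 0 < ballConst d c := by
  unfold ballConst
  have : 0 < Real.Gamma ((d : ℝ) / 2 + 1) := Real.Gamma_pos_of_pos (by positivity)
  have := Real.pi_pos
  positivity

lemma ballConst_radius {d : ℕ} (hd : 0 < d) (c ξ : ℝ) (m : ℕ) :
    ballConst d (radius d c ξ m) = ballConst d c * (m : ℝ) ^ (-ξ) := by
  have hd' : (d : ℝ) ≠ 0 := by positivity
  have : ((m : ℝ) ^ (-ξ / (d : ℝ))) ^ d = (m : ℝ) ^ (-ξ) := by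
    rw [← Real.rpow_natCast, ← Real.rpow_mul (Nat.cast_nonneg m), div_mul_cancel₀ _ hd']
  rw [ballConst, ballConst, radius, mul_pow, this, mul_assoc]

lemma radius_nonneg {d : ℕ} {c : ℝ} (hc : 0 ≤ c) (ξ : ℝ) (m : ℕ) : 0 ≤ radius d c ξ m := by
  unfold radius
  positivity

lemma tendsto_radius {d : ℕ} (hd : 0 < d) (c : ℝ) {ξ : ℝ} (hξ : 0 < ξ) :
    Tendsto (radius d c ξ) atTop (𝓝 0) := by
  have h := (tendsto_rpow_neg_atTop (show 0 < ξ / d by positivity)).comp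
    tendsto_natCast_atTop_atTop
  have h' := h.const_mul c
  rw [mul_zero] at h'
  refine h'.congr fun m => ?_
  simp only [radius, Function.comp_apply, neg_div]

section Sampling

variable {χ : Type*} [Fintype χ] [MeasurableSpace χ] {d : ℕ}
  {Y : Set (EuclideanSpace ℝ (Fin d))} {f σ : χ → EuclideanSpace ℝ (Fin d) → ℝ}
  {a : (t : ℕ) → (Fin t → Obs χ d) → χ → EuclideanSpace ℝ (Fin d) → ℝ}

/-- One step of the Chernoff bound: a hit of the neighbourhood has conditional probability at
least `lamL * v`, with `v` the volume of the neighbourhood, and is given the weight `κ ≤ 1`. -/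
lemma IsSamplingRule.sum_lintegral_hit_le (ha : IsSamplingRule Y a) {lamL : ℝ}
    (hlamL : 0 < lamL) (ha_lower : ∀ t D x, ∀ y ∈ interior Y, lamL < a t D x y) (x : χ)
    (y : EuclideanSpace ℝ (Fin d)) {r v κ : ℝ} (hball : Metric.ball y r ⊆ interior Y)
    (hvol : volume (Metric.ball y r) = ENNReal.ofReal v) (hv : 0 ≤ v)
    (hκ₀ : 0 ≤ κ) (hκ₁ : κ ≤ 1) (t : ℕ) (D : Fin t → Obs χ d) (u : Obs χ d → ℝ≥0∞)
    (hu : ∀ o ∈ hitSet Y x y r, u o = ENNReal.ofReal κ) (hu' : ∀ o ∉ hitSet Y x y r, u o = 1) :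
    ∑ x', ∫⁻ y' in interior Y, (ENNReal.ofReal (a t D x' y') *
      ∫⁻ e, u ((x', y'), f x' y' + e) ∂(gaussianReal 0 (Real.toNNReal (σ x' y' ^ 2)))) ≤
      ENNReal.ofReal (Real.exp (-(lamL * v * (1 - κ)))) := by
  classical
  have hmeas : ∀ x', Measurable fun y' => ENNReal.ofReal (a t D x' y') := fun x' =>
    ENNReal.measurable_ofReal.comp ((ha.measurable t).comp
      (f := fun y' : EuclideanSpace ℝ (Fin d) => (D, (x', y'))) (by fun_prop))
  -- the weight does not depend on the noise
  have hmem : ∀ x' y' e, (((x', y'), e) : Obs χ d) ∈ hitSet Y x y r ↔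
      x' = x ∧ y' ∈ Metric.ball y r := by
    intro x' y' e
    simp only [hitSet, Set.mem_ofPred_eq, Metric.mem_ball, dist_eq_norm]
    exact ⟨fun h => ⟨h.1, h.2.1⟩, fun h => ⟨h.1, h.2, hball (by simpa [dist_eq_norm] using h.2)⟩⟩
  have hκ : ENNReal.ofReal κ + ENNReal.ofReal (1 - κ) = 1 := by
    rw [← ENNReal.ofReal_add hκ₀ (by linarith)]
    simp
  set B := ENNReal.ofReal (lamL * v * (1 - κ)) with hB
  have hstep : ∀ x', (∫⁻ y' in interior Y, (ENNReal.ofReal (a t D x' y') *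
      ∫⁻ e, u ((x', y'), f x' y' + e) ∂(gaussianReal 0 (Real.toNNReal (σ x' y' ^ 2))))) +
      (if x' = x then B else 0) ≤ ∫⁻ y' in interior Y, ENNReal.ofReal (a t D x' y') := by
    intro x'
    by_cases hx : x' = x
    · subst hx
      have h1 : ∀ y', ∫⁻ e, u ((x', y'), f x' y' + e)
          ∂(gaussianReal 0 (Real.toNNReal (σ x' y' ^ 2))) =
          if y' ∈ Metric.ball y r then ENNReal.ofReal κ else 1 := by
        intro y'
        split_ifs with h
        · simp [hu _ ((hmem x' y' _).2 ⟨rfl, h⟩)]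
        · simp [hu' _ (fun h' => h ((hmem x' y' _).1 h').2)]
      have h2 : B ≤ ∫⁻ y' in interior Y, ENNReal.ofReal (a t D x' y') *
          (Metric.ball y r).indicator (fun _ => ENNReal.ofReal (1 - κ)) y' := by
        calc B = ∫⁻ _ in Metric.ball y r, ENNReal.ofReal lamL * ENNReal.ofReal (1 - κ) := by
              rw [setLIntegral_const, hvol, hB, ← ENNReal.ofReal_mul hlamL.le,
                ← ENNReal.ofReal_mul (mul_nonneg hlamL.le (by linarith))]
              congr 1
              ring
          _ ≤ ∫⁻ y' in Metric.ball y r, ENNReal.ofReal (a t D x' y') *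
                (Metric.ball y r).indicator (fun _ => ENNReal.ofReal (1 - κ)) y' := by
              refine setLIntegral_mono' measurableSet_ball fun y' hy' => ?_
              rw [Set.indicator_of_mem hy']
              gcongr
              exact (ha_lower t D x' y' (hball hy')).le
          _ ≤ _ := lintegral_mono_set hball
      simp only [h1, if_true]
      refine (add_le_add_right h2 _).trans ?_
      have hm : Measurable fun y' => ENNReal.ofReal (a t D x' y') *
          (Metric.ball y r).indicator (fun _ => ENNReal.ofReal (1 - κ)) y' :=
        (hmeas x').mul (measurable_const.indicator measurableSet_ball)
      rw [← lintegral_add_right _ hm]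
      refine lintegral_mono fun y' => ?_
      simp only
      rw [← mul_add]
      by_cases h : y' ∈ Metric.ball y r
      · rw [if_pos h, Set.indicator_of_mem h, hκ, mul_one]
      · rw [if_neg h, Set.indicator_of_notMem h, add_zero, mul_one]
    · have h1 : ∀ y', ∫⁻ e, u ((x', y'), f x' y' + e)
          ∂(gaussianReal 0 (Real.toNNReal (σ x' y' ^ 2))) = 1 := fun y' => by
        simp [hu' _ (fun h' => hx ((hmem x' y' _).1 h').1)]
      simp [h1, hx]
  have hsum := Finset.sum_le_sum fun x' (_ : x' ∈ Finset.univ) => hstep x'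
  rw [Finset.sum_add_distrib, ha.total, Finset.sum_ite_eq' Finset.univ x,
    if_pos (Finset.mem_univ x)] at hsum
  refine (ENNReal.le_sub_of_add_le_right ENNReal.ofReal_ne_top hsum).trans ?_
  rw [← ENNReal.ofReal_one, ← ENNReal.ofReal_sub _
    (mul_nonneg (mul_nonneg hlamL.le hv) (by linarith))]
  refine ENNReal.ofReal_le_ofReal ?_
  have := Real.add_one_le_exp (-(lamL * v * (1 - κ)))
  linarith

variable [MeasurableSingletonClass χ] {Ω : Type*} [MeasurableSpace Ω] {P : Measure Ω}
  [IsProbabilityMeasure P] {γ : ℕ → Ω → Obs χ d}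

/-- The Chernoff bound for the number of hits of a neighbourhood of volume `v`. -/
lemma IsSequentialSampling.measure_card_localSet_le (hγ : IsSequentialSampling Y f σ a P γ)
    (ha : IsSamplingRule Y a) {lamL : ℝ} (hlamL : 0 < lamL)
    (ha_lower : ∀ t D x, ∀ y ∈ interior Y, lamL < a t D x y) (x : χ)
    (y : EuclideanSpace ℝ (Fin d)) {r v s : ℝ} (hball : Metric.ball y r ⊆ interior Y)
    (hvol : volume (Metric.ball y r) = ENNReal.ofReal v) (hv : 0 ≤ v) (hs : 1 ≤ s) (t m : ℕ) :
    P {ω | (localSet Y (fun i => γ i ω) t x y r).card < m} ≤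
      ENNReal.ofReal (Real.exp (m * Real.log s - t * (lamL * v * (1 - s⁻¹)))) := by
  classical
  have hs0 : 0 < s := by linarith
  have hs_inv : s⁻¹ ≤ 1 := inv_le_one_of_one_le₀ hs
  set H := hitSet Y x y r with hH_def
  have hH : MeasurableSet H := measurableSet_hitSet Y x y r
  let w : Obs χ d → ℝ≥0∞ := fun o => if o ∈ H then ENNReal.ofReal s⁻¹ else 1
  have hw : Measurable w := Measurable.ite hH measurable_const measurable_const
  let u : (t : ℕ) → (Fin t → Obs χ d) × Obs χ d → ℝ≥0∞ := fun _ p => w p.2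
  have hu : ∀ t, Measurable (u t) := fun t => hw.comp measurable_snd
  have key := hγ.lintegral_prod_le u hu
    (fun t p => by simp only [u, w]; split_ifs <;> simp) (fun _ => _)
    (fun t D => ha.sum_lintegral_hit_le hlamL ha_lower x y hball hvol hv
      (inv_nonneg.2 hs0.le) hs_inv t D w (fun o ho => if_pos ho) (fun o ho => if_neg ho)) t
  have hprod : ∀ ω, ∏ i ∈ Finset.range t, u i (dataset (fun j => γ j ω) i, γ i ω) =
      ENNReal.ofReal s⁻¹ ^ (localSet Y (fun i => γ i ω) t x y r).card := by
    intro ω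
    simp only [u, w]
    rw [← Finset.prod_filter, Finset.prod_const]
    congr 2
    ext i
    rw [mem_localSet, Finset.mem_filter, Finset.mem_range]
  rw [Finset.prod_const, Finset.card_range] at key
  have hmeas : AEMeasurable
      (fun ω => ∏ i ∈ Finset.range t, u i (dataset (fun j => γ j ω) i, γ i ω)) P :=
    (Finset.measurable_prod _ fun i _ => hw.comp (hγ.measurable i)).aemeasurable
  have markov := mul_meas_ge_le_lintegral₀ hmeas (ENNReal.ofReal s⁻¹ ^ m)
  have hsub : P {ω | (localSet Y (fun i => γ i ω) t x y r).card < m} ≤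
      P {ω | ENNReal.ofReal s⁻¹ ^ m ≤
        ∏ i ∈ Finset.range t, u i (dataset (fun j => γ j ω) i, γ i ω)} := by
    refine measure_mono fun ω hω => ?_
    rw [Set.mem_ofPred_eq] at hω ⊢
    rw [hprod]
    exact pow_le_pow_right_of_le_one' (ENNReal.ofReal_le_one.2 hs_inv) hω.le
  have h1 : ENNReal.ofReal (Real.exp (m * Real.log s)) * ENNReal.ofReal s⁻¹ ^ m = 1 := by
    rw [← ENNReal.ofReal_pow (by positivity), ← ENNReal.ofReal_mul (by positivity),
      mul_comm (m : ℝ), Real.exp_mul, Real.exp_log hs0, Real.rpow_natCast, ← mul_pow,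
      mul_inv_cancel₀ hs0.ne', one_pow, ENNReal.ofReal_one]
  calc P {ω | (localSet Y (fun i => γ i ω) t x y r).card < m}
      = ENNReal.ofReal (Real.exp (m * Real.log s)) * (ENNReal.ofReal s⁻¹ ^ m *
          P {ω | (localSet Y (fun i => γ i ω) t x y r).card < m}) := by
        rw [← mul_assoc, h1, one_mul]
    _ ≤ ENNReal.ofReal (Real.exp (m * Real.log s)) *
          ENNReal.ofReal (Real.exp (-(lamL * v * (1 - s⁻¹)))) ^ t := by
        gcongr
        exact ((mul_le_mul_right hsub _).trans markov).trans key
    _ = _ := by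
        rw [← ENNReal.ofReal_pow (by positivity), ← ENNReal.ofReal_mul (by positivity),
          ← Real.exp_nat_mul, ← Real.exp_add]
        congr 2
        ring

/-! ### Comparison of two neighbourhood samples -/

/-- If the weights of the hits of two neighbourhoods, of different decisions, have conditional
expectation at most `1`, then so has the product of the weights of the first `m₁` and the first
`m₂` of these hits. An observation hits at most one of the two neighbourhoods. -/
lemma IsSequentialSampling.lintegral_prod_firstHitsWeight_le
    (hγ : IsSequentialSampling Y f σ a P γ) (ha : IsSamplingRule Y a) {x₁ x₂ : χ}
    (hx : x₁ ≠ x₂) (y : EuclideanSpace ℝ (Fin d)) (r₁ r₂ : ℝ) (m₁ m₂ : ℕ) {h₁ h₂ : ℝ → ℝ≥0∞}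
    (hm₁ : Measurable h₁) (hm₂ : Measurable h₂) (htop₁ : ∀ u, h₁ u ≠ ∞) (htop₂ : ∀ u, h₂ u ≠ ∞)
    (hle₁ : ∀ y' ∈ interior Y, ‖y' - y‖ < r₁ →
      ∫⁻ e, h₁ (f x₁ y' + e) ∂(gaussianReal 0 (Real.toNNReal (σ x₁ y' ^ 2))) ≤ 1)
    (hle₂ : ∀ y' ∈ interior Y, ‖y' - y‖ < r₂ →
      ∫⁻ e, h₂ (f x₂ y' + e) ∂(gaussianReal 0 (Real.toNNReal (σ x₂ y' ^ 2))) ≤ 1) (t : ℕ) :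
    ∫⁻ ω, ∏ i ∈ Finset.range t,
      (firstHitsWeight (hitSet Y x₁ y r₁) m₁ h₁ i (dataset (fun j => γ j ω) i, γ i ω) *
        firstHitsWeight (hitSet Y x₂ y r₂) m₂ h₂ i (dataset (fun j => γ j ω) i, γ i ω)) ∂P ≤
      1 := by
  classical
  have hH₁ := measurableSet_hitSet Y x₁ y r₁
  have hH₂ := measurableSet_hitSet Y x₂ y r₂
  refine (hγ.lintegral_prod_le
    (fun i p => firstHitsWeight (hitSet Y x₁ y r₁) m₁ h₁ i p *
      firstHitsWeight (hitSet Y x₂ y r₂) m₂ h₂ i p)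
    (fun i => (measurable_firstHitsWeight hH₁ m₁ hm₁ i).mul
      (measurable_firstHitsWeight hH₂ m₂ hm₂ i))
    (fun i p => ENNReal.mul_ne_top (firstHitsWeight_ne_top _ _ htop₁ i p)
      (firstHitsWeight_ne_top _ _ htop₂ i p)) (fun _ => 1) (fun i D => ?_) t).trans (by simp)
  rw [← ha.total i D]
  refine Finset.sum_le_sum fun x _ => setLIntegral_mono' isOpen_interior.measurableSet
    fun y' hy' => mul_le_of_le_one_right' ?_
  simp only [firstHitsWeight, hitSet, Set.mem_ofPred_eq, hy', and_true]
  by_cases c₁ : hitCount (hitSet Y x₁ y r₁) D < m₁ ∧ x = x₁ ∧ ‖y' - y‖ < r₁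
  · obtain ⟨c, rfl, hr⟩ := c₁
    simp only [hitSet] at c
    simpa [c, hr, hx] using hle₁ y' hy' hr
  · by_cases c₂ : hitCount (hitSet Y x₂ y r₂) D < m₂ ∧ x = x₂ ∧ ‖y' - y‖ < r₂
    · obtain ⟨c, rfl, hr⟩ := c₂
      simp only [hitSet] at c
      simpa [c, hr, hx.symm] using hle₂ y' hy' hr
    · simp only [hitSet] at c₁ c₂
      simp [c₁, c₂]

end Sampling

/-- The Gaussian exponential moment, normalized by an upper bound `k` for the mean (a lower bound
if `α` is negative) and an upper bound `S` for the standard deviation. -/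
lemma lintegral_exp_gaussianReal_le_one {α g k s S : ℝ} (hg : α * (g - k) ≤ 0) (hs : 0 ≤ s)
    (hS : s ≤ S) :
    ∫⁻ e, ENNReal.ofReal (Real.exp (α * (g + e - k) - (α * S) ^ 2 / 2))
      ∂(gaussianReal 0 (Real.toNNReal (s ^ 2))) ≤ 1 := by
  have hmgf := mgf_gaussianReal (p := gaussianReal 0 (Real.toNNReal (s ^ 2))) (X := id)
    Measure.map_id α
  have hint := integrable_exp_mul_gaussianReal (μ := 0) (v := Real.toNNReal (s ^ 2)) α
  have hcong : ∀ e, Real.exp (α * (g + e - k) - (α * S) ^ 2 / 2) =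
      Real.exp (α * (g - k) - (α * S) ^ 2 / 2) * Real.exp (α * e) := fun e => by
    rw [← Real.exp_add]
    congr 1
    ring
  simp only [mgf, id, Real.coe_toNNReal _ (sq_nonneg s)] at hmgf
  simp only [hcong]
  rw [← ofReal_integral_eq_lintegral_ofReal (hint.const_mul _)
    (ae_of_all _ fun e => by positivity), integral_const_mul, hmgf, ← Real.exp_add]
  refine ENNReal.ofReal_le_one.2 (Real.exp_le_one_iff.2 ?_)
  have : α ^ 2 * s ^ 2 ≤ α ^ 2 * S ^ 2 := by gcongr
  nlinarith

/-- Exponential Chebyshev bound for the difference of two sample averages: the exponent left once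
the parameter is optimized for the common sample size `μ`. -/
lemma exp_bound_le_prod_exp {δ A B μ m₁ m₂ F₁ F₂ k₁ k₂ : ℝ} (hA : 0 < A) (hB : 0 < B)
    (hμ : 0 < μ) (h₁ : μ ≤ m₁) (h₂ : μ ≤ m₂) (hδ : 0 < δ) (hk : k₂ - k₁ = δ) (hF : F₂ ≤ F₁) :
    μ * (δ ^ 2 / (2 * (A ^ 2 + B ^ 2))) ≤
      (μ * δ / (A ^ 2 + B ^ 2) * (F₁ - k₁) - m₁ * (μ * δ / (A ^ 2 + B ^ 2) / m₁ * A) ^ 2 / 2) +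
      (-(μ * δ / (A ^ 2 + B ^ 2)) * (F₂ - k₂) -
        m₂ * (-(μ * δ / (A ^ 2 + B ^ 2)) / m₂ * B) ^ 2 / 2) := by
  set θ := μ * δ / (A ^ 2 + B ^ 2) with hθ
  have hθ0 : 0 < θ := by positivity
  have hm₁ : 0 < m₁ := hμ.trans_le h₁
  have hm₂ : 0 < m₂ := hμ.trans_le h₂
  have e₁ : m₁ * (θ / m₁ * A) ^ 2 ≤ θ ^ 2 * A ^ 2 / μ := by
    calc m₁ * (θ / m₁ * A) ^ 2 = θ ^ 2 * A ^ 2 / m₁ := by field_simp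
      _ ≤ _ := by gcongr
  have e₂ : m₂ * (-θ / m₂ * B) ^ 2 ≤ θ ^ 2 * B ^ 2 / μ := by
    calc m₂ * (-θ / m₂ * B) ^ 2 = θ ^ 2 * B ^ 2 / m₂ := by field_simp
      _ ≤ _ := by gcongr
  have e₃ : θ * δ ≤ θ * (F₁ - k₁) + -θ * (F₂ - k₂) := by nlinarith
  have e₄ : μ * (δ ^ 2 / (2 * (A ^ 2 + B ^ 2))) =
      θ * δ - (θ ^ 2 * A ^ 2 / μ + θ ^ 2 * B ^ 2 / μ) / 2 := by
    rw [hθ]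
    field_simp
    ring
  linarith

lemma prod_exp_eq_exp_average {S : Finset ℕ} {m : ℕ} (hS : S.card = m) (hm : 0 < m) (G : ℕ → ℝ)
    (β k A : ℝ) :
    ∏ i ∈ S, ENNReal.ofReal (Real.exp (β / m * (G i - k) - (β / m * A) ^ 2 / 2)) =
      ENNReal.ofReal (Real.exp (β * (1 / (m : ℝ) * ∑ i ∈ S, G i - k) -
        m * (β / m * A) ^ 2 / 2)) := by
  have hm' : (m : ℝ) ≠ 0 := by positivity
  rw [← ENNReal.ofReal_prod_of_nonneg fun _ _ => by positivity, ← Real.exp_sum]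
  congr 2
  rw [Finset.sum_sub_distrib, ← Finset.mul_sum, Finset.sum_sub_distrib, Finset.sum_const,
    Finset.sum_const, hS, nsmul_eq_mul, nsmul_eq_mul]
  field_simp

/-- On the event that the frozen samples of the two decisions have given sizes `m₁` and `m₂`, both
at least `μ`, the decision `x₂` with the larger mean is estimated to be no worse than `x₁` with
exponentially small probability. The radii are at most `ρ`, so the Lipschitz conditions bound
the bias by `L₁ * ρ` and the standard deviations by `σ x y + L₂ * ρ`. -/
lemma IsSequentialSampling.measure_sneEstimator_le {χ : Type*} [Fintype χ] [MeasurableSpace χ]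
    [MeasurableSingletonClass χ] {d : ℕ} {Y : Set (EuclideanSpace ℝ (Fin d))}
    {f σ : χ → EuclideanSpace ℝ (Fin d) → ℝ}
    {a : (t : ℕ) → (Fin t → Obs χ d) → χ → EuclideanSpace ℝ (Fin d) → ℝ}
    {Ω : Type*} [MeasurableSpace Ω] {P : Measure Ω} [IsProbabilityMeasure P]
    {γ : ℕ → Ω → Obs χ d} (hγ : IsSequentialSampling Y f σ a P γ) (ha : IsSamplingRule Y a)
    {L₁ L₂ : ℝ≥0} (hf_lip : ∀ x, LipschitzOnWith L₁ (f x) Y)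
    (hσ_pos : ∀ x, ∀ y ∈ Y, 0 < σ x y) (hσ_lip : ∀ x, LipschitzOnWith L₂ (σ x) Y)
    {y : EuclideanSpace ℝ (Fin d)} (hy : y ∈ interior Y) {x₁ x₂ : χ} (hx : x₁ ≠ x₂)
    {c ξ ρ : ℝ} (hρ : 0 ≤ ρ) (hδ : 0 < f x₂ y - f x₁ y - 2 * L₁ * ρ) {μ m₁ m₂ : ℕ} (hμ : 0 < μ)
    (hm₁ : μ ≤ m₁) (hm₂ : μ ≤ m₂) (hr₁ : radius d c ξ m₁ ≤ ρ) (hr₂ : radius d c ξ m₂ ≤ ρ)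
    (t : ℕ) :
    P {ω | nbhdSize Y c ξ (fun i => γ i ω) t x₁ y = m₁ ∧
        nbhdSize Y c ξ (fun i => γ i ω) t x₂ y = m₂ ∧
        sneEstimator Y c ξ (fun i => γ i ω) t x₂ y ≤
          sneEstimator Y c ξ (fun i => γ i ω) t x₁ y} ≤
      ENNReal.ofReal (Real.exp (-(μ * ((f x₂ y - f x₁ y - 2 * L₁ * ρ) ^ 2 /
        (2 * ((σ x₁ y + L₂ * ρ) ^ 2 + (σ x₂ y + L₂ * ρ) ^ 2)))))) := by
  have hyY : y ∈ Y := interior_subset hy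
  set δ := f x₂ y - f x₁ y - 2 * L₁ * ρ with hδ_def
  set A := σ x₁ y + L₂ * ρ with hA_def
  set B := σ x₂ y + L₂ * ρ with hB_def
  have hA : 0 < A := add_pos_of_pos_of_nonneg (hσ_pos x₁ y hyY) (by positivity)
  have hB : 0 < B := add_pos_of_pos_of_nonneg (hσ_pos x₂ y hyY) (by positivity)
  have hμ' : (0 : ℝ) < μ := by positivity
  have hm₁0 : 0 < m₁ := hμ.trans_le hm₁
  have hm₂0 : 0 < m₂ := hμ.trans_le hm₂
  set θ := μ * δ / (A ^ 2 + B ^ 2) with hθ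
  have hθ0 : 0 < θ := by positivity
  set k₁ := f x₁ y + L₁ * ρ with hk₁
  set k₂ := f x₂ y - L₁ * ρ with hk₂
  have hf : ∀ x, ∀ y' ∈ interior Y, ‖y' - y‖ ≤ ρ → |f x y' - f x y| ≤ L₁ * ρ := by
    intro x y' hy' h
    have := (hf_lip x).dist_le_mul y' (interior_subset hy') y hyY
    rw [Real.dist_eq, dist_eq_norm] at this
    exact this.trans (by gcongr)
  have hσ : ∀ x, ∀ y' ∈ interior Y, ‖y' - y‖ ≤ ρ → σ x y' ≤ σ x y + L₂ * ρ := by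
    intro x y' hy' h
    have := (hσ_lip x).dist_le_mul y' (interior_subset hy') y hyY
    rw [Real.dist_eq, dist_eq_norm] at this
    have h2 : (L₂ : ℝ) * ‖y' - y‖ ≤ L₂ * ρ := by gcongr
    linarith [le_abs_self (σ x y' - σ x y)]
  let h : ℝ → ℝ → ℝ → ℝ → ℝ≥0∞ := fun α k S G =>
    ENNReal.ofReal (Real.exp (α * (G - k) - (α * S) ^ 2 / 2))
  have hmeas : ∀ α k S, Measurable (h α k S) := fun α k S => by fun_prop
  have key := hγ.lintegral_prod_firstHitsWeight_le ha hx y (radius d c ξ m₁) (radius d c ξ m₂)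
    m₁ m₂ (hmeas (θ / m₁) k₁ A) (hmeas (-θ / m₂) k₂ B) (fun _ => ENNReal.ofReal_ne_top)
    (fun _ => ENNReal.ofReal_ne_top)
    (fun y' hy' hr => by
      refine lintegral_exp_gaussianReal_le_one ?_ (hσ_pos _ _ (interior_subset hy')).le
        (hσ x₁ y' hy' (hr.le.trans hr₁))
      have := (abs_le.1 (hf x₁ y' hy' (hr.le.trans hr₁))).2
      exact mul_nonpos_of_nonneg_of_nonpos (by positivity) (by linarith))
    (fun y' hy' hr => by
      refine lintegral_exp_gaussianReal_le_one ?_ (hσ_pos _ _ (interior_subset hy')).le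
        (hσ x₂ y' hy' (hr.le.trans hr₂))
      have := (abs_le.1 (hf x₂ y' hy' (hr.le.trans hr₂))).1
      refine mul_nonpos_of_nonpos_of_nonneg ?_ (by linarith)
      rw [neg_div]
      exact neg_nonpos.2 (by positivity)) t
  set W : Ω → ℝ≥0∞ := fun ω => ∏ i ∈ Finset.range t,
      (firstHitsWeight (hitSet Y x₁ y (radius d c ξ m₁)) m₁ (h (θ / m₁) k₁ A) i
          (dataset (fun j => γ j ω) i, γ i ω) *
        firstHitsWeight (hitSet Y x₂ y (radius d c ξ m₂)) m₂ (h (-θ / m₂) k₂ B) i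
          (dataset (fun j => γ j ω) i, γ i ω)) with hW
  have hWmeas : Measurable W := by
    refine Finset.measurable_prod _ fun i _ => ?_
    have hp : Measurable fun ω => (dataset (fun j => γ j ω) i, γ i ω) :=
      (measurable_dataset hγ.measurable i).prodMk (hγ.measurable i)
    exact ((measurable_firstHitsWeight (measurableSet_hitSet Y x₁ y _) m₁ (hmeas _ _ _) i).comp
      hp).mul ((measurable_firstHitsWeight (measurableSet_hitSet Y x₂ y _) m₂
        (hmeas _ _ _) i).comp hp)
  set E := μ * (δ ^ 2 / (2 * (A ^ 2 + B ^ 2))) with hE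
  have hsub : {ω | nbhdSize Y c ξ (fun i => γ i ω) t x₁ y = m₁ ∧
        nbhdSize Y c ξ (fun i => γ i ω) t x₂ y = m₂ ∧
        sneEstimator Y c ξ (fun i => γ i ω) t x₂ y ≤
          sneEstimator Y c ξ (fun i => γ i ω) t x₁ y} ⊆
      {ω | ENNReal.ofReal (Real.exp E) ≤ W ω} := by
    rintro ω ⟨e₁, e₂, hle⟩
    have a₁ := nbhdSize_le_card (c := c) (ξ := ξ) (Y := Y) (s := fun i => γ i ω) (t := t)
      (x := x₁) (y := y) (by omega)
    have a₂ := nbhdSize_le_card (c := c) (ξ := ξ) (Y := Y) (s := fun i => γ i ω) (t := t)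
      (x := x₂) (y := y) (by omega)
    rw [e₁] at a₁
    rw [e₂] at a₂
    rw [Set.mem_ofPred_eq, hW]
    simp only
    rw [Finset.prod_mul_distrib, prod_firstHitsWeight (s := fun i => γ i ω) a₁,
      prod_firstHitsWeight (s := fun i => γ i ω) a₂]
    simp only [h]
    rw [prod_exp_eq_exp_average (card_mSet_activationTime a₁) hm₁0,
      prod_exp_eq_exp_average (card_mSet_activationTime a₂) hm₂0,
      ← ENNReal.ofReal_mul (by positivity), ← Real.exp_add]
    refine ENNReal.ofReal_le_ofReal (Real.exp_le_exp.2 ?_)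
    simp only [sneEstimator, nbhd, e₁, e₂] at hle
    exact exp_bound_le_prod_exp hA hB hμ' (by exact_mod_cast hm₁) (by exact_mod_cast hm₂) hδ
      (by rw [hk₁, hk₂, hδ_def]; ring) hle
  have markov := mul_meas_ge_le_lintegral₀ (μ := P) hWmeas.aemeasurable
    (ENNReal.ofReal (Real.exp E))
  calc _ ≤ P {ω | ENNReal.ofReal (Real.exp E) ≤ W ω} := measure_mono hsub
    _ = ENNReal.ofReal (Real.exp (-E)) * (ENNReal.ofReal (Real.exp E) *
          P {ω | ENNReal.ofReal (Real.exp E) ≤ W ω}) := by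
        rw [← mul_assoc, ← ENNReal.ofReal_mul (by positivity), ← Real.exp_add]
        simp
    _ ≤ ENNReal.ofReal (Real.exp (-E)) * 1 := by
        gcongr
        exact markov.trans key
    _ = _ := mul_one _

/-! ### The constants of the rate -/

/-- With `s = -W₋₁(-e^(-z-1))`, the Poisson-type exponent `s - 1 - log s` of the Chernoff bound
equals `z`. -/
lemma neg_lambertWLower_spec {z : ℝ} (hz : 0 ≤ z) :
    1 ≤ -lambertWLower (-Real.exp (-z - 1)) ∧
      -lambertWLower (-Real.exp (-z - 1)) - 1 -
        Real.log (-lambertWLower (-Real.exp (-z - 1))) = z := by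
  set q := Real.exp (-z - 1) with hq
  have hq0 : 0 < q := Real.exp_pos _
  set S : Set ℝ := {w : ℝ | w ≤ -1 ∧ w * Real.exp w = -q} with hS
  have hcont : Continuous fun w : ℝ => w * Real.exp w := by fun_prop
  -- `|w| * e ^ w ≤ 2 / |w|` for negative `w`
  have hsmall : ∀ w : ℝ, w < 0 → -(w * Real.exp w) * (-w) ≤ 2 := by
    intro w hw
    have h1 := Real.quadratic_le_exp_of_nonneg (neg_nonneg.2 hw.le)
    have h2 : Real.exp w * Real.exp (-w) = 1 := by rw [← Real.exp_add]; simp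
    have h3 := Real.exp_pos w
    nlinarith
  have hne : S.Nonempty := by
    have hle : -(2 / q) - 1 ≤ -1 := by
      have : 0 < 2 / q := by positivity
      linarith
    have hmem : -q ∈ Set.Icc ((-1 : ℝ) * Real.exp (-1))
        ((-(2 / q) - 1) * Real.exp (-(2 / q) - 1)) := by
      constructor
      · have : q ≤ Real.exp (-1) := Real.exp_le_exp.2 (by linarith)
        linarith
      · have hw : -(2 / q) - 1 < 0 := by linarith
        have := hsmall _ hw
        by_contra! hlt
        have h4 : q * (2 / q + 1) < 2 :=
          lt_of_lt_of_le (b := -((-(2 / q) - 1) * Real.exp (-(2 / q) - 1)) * (2 / q + 1))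
            (by gcongr; linarith) (by linarith)
        have h5 : q * (2 / q + 1) = 2 + q := by field_simp
        linarith
    obtain ⟨w, hw, hwq⟩ := intermediate_value_Icc' hle hcont.continuousOn hmem
    exact ⟨w, hw.2, hwq⟩
  have hbdd : BddBelow S := by
    refine ⟨-(2 / q), fun w hw => ?_⟩
    have := hsmall w (by linarith [hw.1])
    rw [hw.2, neg_neg] at this
    have : -w ≤ 2 / q := by rw [le_div_iff₀ hq0]; linarith
    linarith
  have hclosed : IsClosed S :=
    (isClosed_le continuous_id continuous_const).inter (isClosed_eq hcont continuous_const)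
  obtain ⟨h1, h2⟩ : lambertWLower (-q) ∈ S := hclosed.csInf_mem hne hbdd
  refine ⟨by linarith, ?_⟩
  have h3 : Real.log (-lambertWLower (-q) * Real.exp (lambertWLower (-q))) = -z - 1 := by
    rw [neg_mul, h2, neg_neg, hq, Real.log_exp]
  rw [Real.log_mul (by linarith) (Real.exp_pos _).ne', Real.log_exp] at h3
  linarith

lemma lt_of_argminSet_eq {χ : Type*} {d : ℕ} {f : χ → EuclideanSpace ℝ (Fin d) → ℝ}
    {y : EuclideanSpace ℝ (Fin d)} {xs : χ} (hxs : argminSet (fun x => f x y) = {xs}) {x : χ}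
    (hx : x ≠ xs) :
    f xs y < f x y := by
  have hmem : xs ∈ argminSet fun x => f x y := hxs ▸ Set.mem_singleton xs
  by_contra! hle
  have : x ∈ argminSet fun x => f x y := fun x' => hle.trans (hmem x')
  rw [hxs] at this
  exact hx this

section Zeta

variable {χ : Type*} [Fintype χ] {d : ℕ} {f σ : χ → EuclideanSpace ℝ (Fin d) → ℝ}
  {y : EuclideanSpace ℝ (Fin d)} {xs : χ}

lemma zeta_le {x : χ} (hx : x ≠ xs) :
    zeta f σ y xs ≤ (f x y - f xs y) ^ 2 / (2 * (σ xs y ^ 2 + σ x y ^ 2)) :=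
  ciInf_le (Set.finite_range _).bddBelow (⟨x, hx⟩ : {x : χ // x ≠ xs})

lemma zeta_pos [Nontrivial χ] (hxs : argminSet (fun x => f x y) = {xs})
    (hσ : ∀ x, 0 < σ x y) : 0 < zeta f σ y xs := by
  have : Nonempty {x : χ // x ≠ xs} := 
    let ⟨x, hx⟩ := exists_ne xs
    ⟨⟨x, hx⟩⟩
  obtain ⟨⟨x, hx⟩, he⟩ := exists_eq_ciInf_of_finite (f := fun x : {x : χ // x ≠ xs} =>
    (f x y - f xs y) ^ 2 / (2 * (σ xs y ^ 2 + σ x y ^ 2)))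
  rw [zeta, ← he]
  have h1 := sub_pos.2 (lt_of_argminSet_eq hxs hx)
  have h2 := hσ x
  have h3 := hσ xs
  positivity

/-- On small neighbourhoods, the separation exponents corrected for bias and for the variation of
the noise stay above any number smaller than `zeta`. -/
lemma eventually_lt_exponent (hxs : argminSet (fun x => f x y) = {xs}) (hσ : ∀ x, 0 < σ x y)
    (L₁ L₂ : ℝ) {z : ℝ} (hz : z < zeta f σ y xs) :
    ∀ᶠ ρ in 𝓝 (0 : ℝ), ∀ x, x ≠ xs → 0 < f x y - f xs y - 2 * L₁ * ρ ∧
      z < (f x y - f xs y - 2 * L₁ * ρ) ^ 2 /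
        (2 * ((σ xs y + L₂ * ρ) ^ 2 + (σ x y + L₂ * ρ) ^ 2)) := by
  refine eventually_all.2 fun x => ?_
  by_cases hx : x = xs
  · exact Eventually.of_forall fun _ h => absurd hx h
  have h1 : ContinuousAt (fun ρ : ℝ => f x y - f xs y - 2 * L₁ * ρ) 0 := by fun_prop
  have h2 : ContinuousAt (fun ρ : ℝ => (f x y - f xs y - 2 * L₁ * ρ) ^ 2 /
      (2 * ((σ xs y + L₂ * ρ) ^ 2 + (σ x y + L₂ * ρ) ^ 2))) 0 := by
    refine ContinuousAt.div (by fun_prop) (by fun_prop) ?_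
    have := hσ x
    have := hσ xs
    simp only [mul_zero, add_zero]
    positivity
  have e1 := h1.eventually (lt_mem_nhds (a := 0)
    (by simpa using lt_of_argminSet_eq hxs hx))
  have e2 := h2.eventually (lt_mem_nhds (a := z)
    (by simpa using hz.trans_le (zeta_le hx)))
  filter_upwards [e1, e2] with ρ a1 a2 _
  exact ⟨a1, a2⟩

end Zeta

/-! ### The decision loss -/

/-- The error bound at a single level `μ`: either some `μ`-set is not activated, or all frozen
samples have at least `μ` elements and a pairwise comparison goes wrong. The first has probability
at most `exp (-z μ)` because the expected number of hits exceeds `μ` by a factor `s` whose Chernoff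
exponent is at least `z`, the second because all separation exponents exceed `z`. -/
lemma IsSequentialSampling.measure_ne_le {χ : Type*} [Fintype χ] [MeasurableSpace χ]
    [MeasurableSingletonClass χ] {d : ℕ} (hd : 0 < d) {Y : Set (EuclideanSpace ℝ (Fin d))}
    {f σ : χ → EuclideanSpace ℝ (Fin d) → ℝ}
    {a : (t : ℕ) → (Fin t → Obs χ d) → χ → EuclideanSpace ℝ (Fin d) → ℝ}
    {Ω : Type*} [MeasurableSpace Ω] {P : Measure Ω} [IsProbabilityMeasure P]
    {γ : ℕ → Ω → Obs χ d} (hγ : IsSequentialSampling Y f σ a P γ) (ha : IsSamplingRule Y a)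
    {lamL : ℝ} (hlamL : 0 < lamL) (ha_lower : ∀ t D x, ∀ y ∈ interior Y, lamL < a t D x y)
    {L₁ L₂ : ℝ≥0} (hf_lip : ∀ x, LipschitzOnWith L₁ (f x) Y)
    (hσ_pos : ∀ x, ∀ y ∈ Y, 0 < σ x y) (hσ_lip : ∀ x, LipschitzOnWith L₂ (σ x) Y)
    {c ξ : ℝ} (hc : 0 < c)
    {y : EuclideanSpace ℝ (Fin d)} (hy : y ∈ interior Y) {xs : χ} {xhat : ℕ → Ω → χ}
    (hxhat : IsInferredDecision Y c ξ γ y xhat) {ρ z s : ℝ} {μ t : ℕ} (hρ : 0 ≤ ρ)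
    (hsep : ∀ x, x ≠ xs → 0 < f x y - f xs y - 2 * L₁ * ρ ∧
      z < (f x y - f xs y - 2 * L₁ * ρ) ^ 2 /
        (2 * ((σ xs y + L₂ * ρ) ^ 2 + (σ x y + L₂ * ρ) ^ 2)))
    (hμ : 0 < μ) (hr : ∀ m ≥ μ, radius d c ξ m ≤ ρ)
    (hball : Metric.ball y (radius d c ξ μ) ⊆ interior Y) (hs : 1 ≤ s)
    (hz : z ≤ s - 1 - Real.log s)
    (hmean : s * μ ≤ t * (lamL * ballConst d (radius d c ξ μ))) :
    P {ω | xhat t ω ≠ xs} ≤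
      ENNReal.ofReal (Fintype.card χ * (1 + ((t : ℝ) + 1) ^ 2) * Real.exp (-(z * μ))) := by
  classical
  have hs0 : 0 < s := by linarith
  set q := ENNReal.ofReal (Real.exp (-(z * μ))) with hq
  let A : χ → Set Ω := fun x =>
    {ω | (localSet Y (fun i => γ i ω) t x y (radius d c ξ μ)).card < μ}
  let B : χ × ℕ × ℕ → Set Ω := fun p =>
    {ω | nbhdSize Y c ξ (fun i => γ i ω) t xs y = p.2.1 ∧
      nbhdSize Y c ξ (fun i => γ i ω) t p.1 y = p.2.2 ∧
      sneEstimator Y c ξ (fun i => γ i ω) t p.1 y ≤ sneEstimator Y c ξ (fun i => γ i ω) t xs y}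
  let I : Finset (χ × ℕ × ℕ) :=
    (Finset.univ.filter (· ≠ xs)) ×ˢ (Finset.Icc μ t ×ˢ Finset.Icc μ t)
  have hA : ∀ x, P (A x) ≤ q := by
    intro x
    have hv : 0 ≤ ballConst d (radius d c ξ μ) :=
      (ballConst_pos d (by unfold radius; positivity)).le
    refine (hγ.measure_card_localSet_le ha hlamL ha_lower x y hball
      (volume_ball_eq_ballConst hd y (radius_nonneg hc.le ξ μ)) hv hs t μ).trans ?_
    refine ENNReal.ofReal_le_ofReal (Real.exp_le_exp.2 ?_)
    have h1 : s * μ * (1 - s⁻¹) ≤ t * (lamL * ballConst d (radius d c ξ μ)) * (1 - s⁻¹) :=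
      mul_le_mul_of_nonneg_right hmean (sub_nonneg.2 (inv_le_one_of_one_le₀ hs))
    have h2 : s * μ * (1 - s⁻¹) = μ * (s - 1) := by field_simp
    have h3 : (μ : ℝ) * z ≤ μ * (s - 1 - Real.log s) := by gcongr
    linarith
  have hB : ∀ p ∈ I, P (B p) ≤ q := by
    rintro ⟨x, m₁, m₂⟩ hp
    simp only [I, Finset.mem_product, Finset.mem_filter, Finset.mem_univ, true_and,
      Finset.mem_Icc] at hp
    obtain ⟨hx, hm₁, hm₂⟩ := hp
    obtain ⟨hδ, hz'⟩ := hsep x hx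
    refine (hγ.measure_sneEstimator_le ha hf_lip hσ_pos hσ_lip hy hx.symm hρ hδ hμ hm₁.1 hm₂.1
      (hr _ hm₁.1) (hr _ hm₂.1) t).trans ?_
    refine ENNReal.ofReal_le_ofReal (Real.exp_le_exp.2 (neg_le_neg ?_))
    rw [mul_comm]
    gcongr
  have hcover : {ω | xhat t ω ≠ xs} ⊆ (⋃ x ∈ Finset.univ, A x) ∪ ⋃ p ∈ I, B p := by
    intro ω hω
    by_cases hact : ∃ x, ω ∈ A x
    · obtain ⟨x, hx⟩ := hact
      exact Or.inl (Set.mem_biUnion (Finset.mem_coe.2 (Finset.mem_univ x)) hx)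
    · push Not at hact
      have hsize : ∀ x, μ ≤ nbhdSize Y c ξ (fun i => γ i ω) t x y := fun x =>
        le_nbhdSize (not_lt.1 (hact x))
      have hmin := hxhat.mem_argmin t ω (fun x => hμ.trans_le (hsize x))
      refine Or.inr (Set.mem_biUnion (x := (xhat t ω, nbhdSize Y c ξ (fun i => γ i ω) t xs y,
        nbhdSize Y c ξ (fun i => γ i ω) t (xhat t ω) y)) ?_ ⟨rfl, rfl, hmin xs⟩)
      simp only [I, Finset.mem_coe, Finset.mem_product, Finset.mem_filter, Finset.mem_univ,
        true_and, Finset.mem_Icc]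
      exact ⟨hω, ⟨hsize _, nbhdSize_le⟩, hsize _, nbhdSize_le⟩
  have hI : (I.card : ℝ≥0∞) ≤ ENNReal.ofReal (Fintype.card χ * ((t : ℝ) + 1) ^ 2) := by
    have h1 : I.card ≤ Fintype.card χ * ((t + 1) * (t + 1)) := by
      simp only [I, Finset.card_product, Nat.card_Icc]
      have := Finset.card_filter_le (Finset.univ : Finset χ) (· ≠ xs)
      rw [Finset.card_univ] at this
      gcongr <;> omega
    rw [← ENNReal.ofReal_natCast]
    refine ENNReal.ofReal_le_ofReal ?_
    rw [pow_two]
    exact_mod_cast h1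
  calc P {ω | xhat t ω ≠ xs}
      ≤ P (⋃ x ∈ Finset.univ, A x) + P (⋃ p ∈ I, B p) :=
        (measure_mono hcover).trans (measure_union_le _ _)
    _ ≤ ∑ _x : χ, q + ∑ _p ∈ I, q := by
        gcongr
        · exact (measure_biUnion_finset_le _ _).trans (Finset.sum_le_sum fun x _ => hA x)
        · exact (measure_biUnion_finset_le _ _).trans (Finset.sum_le_sum hB)
    _ = (Fintype.card χ : ℝ≥0∞) * q + I.card * q := by
        rw [Finset.sum_const, Finset.sum_const, nsmul_eq_mul, nsmul_eq_mul, Finset.card_univ]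
    _ ≤ ENNReal.ofReal (Fintype.card χ) * q +
          ENNReal.ofReal (Fintype.card χ * ((t : ℝ) + 1) ^ 2) * q := by
        rw [ENNReal.ofReal_natCast]
        gcongr
    _ = _ := by
        rw [← add_mul, ← ENNReal.ofReal_add (by positivity) (by positivity), hq,
          ← ENNReal.ofReal_mul (by positivity)]
        congr 1
        ring

/-- The loss is at most a constant multiple of the probability of a wrong decision. -/
lemma condLoss_le {χ : Type*} [Fintype χ] [MeasurableSpace χ] [MeasurableSingletonClass χ] {d : ℕ}
    (f : χ → EuclideanSpace ℝ (Fin d) → ℝ) {dm : ℝ → ℝ → ℝ} (hdm : IsMetricFun dm) {Ω : Type*}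
    [MeasurableSpace Ω] (P : Measure Ω) (y : EuclideanSpace ℝ (Fin d)) (xs : χ) {xhat : Ω → χ}
    (hxhat : Measurable xhat) :
    condLoss f dm P y xs xhat ≤
      ENNReal.ofReal (∑ x, |dm (f x y) (f xs y)|) * P {ω | xhat ω ≠ xs} := by
  have hmeas : MeasurableSet {ω | xhat ω ≠ xs} := (hxhat (measurableSet_singleton xs)).compl
  rw [← lintegral_indicator_const hmeas, condLoss]
  refine lintegral_mono fun ω => ?_
  by_cases h : xhat ω = xs
  · simp [h, (hdm.eq_zero_iff _ _).2 rfl]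
  · rw [Set.indicator_of_mem (show ω ∈ {ω | xhat ω ≠ xs} from h)]
    refine ENNReal.ofReal_le_ofReal ((le_abs_self _).trans ?_)
    exact Finset.single_le_sum (f := fun x => |dm (f x y) (f xs y)|)
      (fun _ _ => abs_nonneg _) (Finset.mem_univ (xhat ω))

/-- Polynomial factors, and rounding the level `A t ^ β` down, do not affect the rate. -/
lemma eventually_poly_mul_exp_floor_le {K A β z H : ℝ} (hK : 0 ≤ K) (hβ : 0 < β) (hz : 0 ≤ z)
    (hH : H < z * A) :
    ∀ᶠ t : ℕ in atTop, K * (1 + ((t : ℝ) + 1) ^ 2) * Real.exp (-(z * ⌊A * (t : ℝ) ^ β⌋₊)) ≤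
      Real.exp (-(H * (t : ℝ) ^ β)) := by
  have hpow : Tendsto (fun t : ℕ => (t : ℝ) ^ β) atTop atTop :=
    (tendsto_rpow_atTop hβ).comp tendsto_natCast_atTop_atTop
  have hlim := ((tendsto_rpow_mul_exp_neg_mul_atTop_nhds_zero (2 / β) (z * A - H)
    (sub_pos.2 hH)).comp hpow).const_mul (K * 5 * Real.exp z)
  rw [mul_zero] at hlim
  filter_upwards [hlim.eventually_le_const one_pos, eventually_ge_atTop 1] with t ht ht1
  have ht1' : (1 : ℝ) ≤ t := by exact_mod_cast ht1
  set w := (t : ℝ) ^ β with hw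
  have hw2 : w ^ (2 / β) = (t : ℝ) ^ 2 := by
    rw [hw, ← Real.rpow_mul (by positivity), mul_div_cancel₀ _ hβ.ne', Real.rpow_two]
  simp only [Function.comp_apply, ← hw, hw2] at ht
  have hfloor : A * w - 1 ≤ ⌊A * w⌋₊ := (Nat.sub_one_lt_floor _).le
  have hzf : z * (A * w - 1) ≤ z * ⌊A * w⌋₊ := by gcongr
  calc K * (1 + ((t : ℝ) + 1) ^ 2) * Real.exp (-(z * ⌊A * w⌋₊))
      ≤ K * (5 * (t : ℝ) ^ 2) * Real.exp (z + -(z * A - H) * w + -(H * w)) := by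
        gcongr
        · nlinarith
        · linarith
    _ = K * 5 * Real.exp z * ((t : ℝ) ^ 2 * Real.exp (-(z * A - H) * w)) *
          Real.exp (-(H * w)) := by
        rw [Real.exp_add, Real.exp_add]
        ring
    _ ≤ 1 * Real.exp (-(H * w)) := by gcongr
    _ = _ := one_mul _

/-- An exponential bound for a quantity gives the corresponding bound for its decay rate, also
where the quantity vanishes and its logarithm is `⊥`. -/
lemma le_neg_inv_mul_log {u : ℝ≥0∞} {H w : ℝ} (hw : 0 < w)
    (hu : u ≤ ENNReal.ofReal (Real.exp (-(H * w)))) :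
    (H : EReal) ≤ ((-(1 / w) : ℝ) : EReal) * ENNReal.log u := by
  have h1 := ENNReal.log_le_log hu
  rw [ENNReal.log_ofReal, if_neg (not_le.2 (Real.exp_pos _)), Real.log_exp] at h1
  have h2 : ((1 / w : ℝ) : EReal) * ENNReal.log u ≤
      ((1 / w : ℝ) : EReal) * ((-(H * w) : ℝ) : EReal) :=
    mul_le_mul_of_nonneg_left h1 (EReal.coe_nonneg.2 (by positivity))
  rw [← EReal.coe_mul] at h2
  rw [EReal.coe_neg, EReal.neg_mul, EReal.le_neg, ← EReal.coe_neg]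
  convert h2 using 2
  field_simp

theorem theorem2 {χ : Type*} [Fintype χ] [Nontrivial χ] [MeasurableSpace χ]
    [MeasurableSingletonClass χ] {d : ℕ} (hd : 0 < d)
    (Y : Set (EuclideanSpace ℝ (Fin d))) (hY : Bornology.IsBounded Y)
    (f σ : χ → EuclideanSpace ℝ (Fin d) → ℝ)
    (L₁ L₂ : ℝ≥0) (hL₁ : 0 < L₁) (hL₂ : 0 < L₂)
    (hf_bdd : ∃ M : ℝ, ∀ x, ∀ y ∈ Y, |f x y| ≤ M)
    (hf_lip : ∀ x, LipschitzOnWith L₁ (f x) Y)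
    (hσ_pos : ∀ x, ∀ y ∈ Y, 0 < σ x y)
    (hσ_lip : ∀ x, LipschitzOnWith L₂ (σ x) Y)
    (c ξ : ℝ) (hc : 0 < c) (hξ : 0 < ξ)
    (dm : ℝ → ℝ → ℝ) (hdm : IsMetricFun dm)
    (a : (t : ℕ) → (Fin t → Obs χ d) → χ → EuclideanSpace ℝ (Fin d) → ℝ)
    (ha : IsSamplingRule Y a)
    (lamL : ℝ) (hlamL : 0 < lamL)
    (ha_lower : ∀ t D x, ∀ y ∈ interior Y, lamL < a t D x y)
    {Ω : Type*} [MeasurableSpace Ω] (P : Measure Ω) [IsProbabilityMeasure P]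
    (γ : ℕ → Ω → Obs χ d) (hγ : IsSequentialSampling Y f σ a P γ)
    (y : EuclideanSpace ℝ (Fin d)) (hy : y ∈ interior Y)
    (xs : χ) (hxs : argminSet (fun x => f x y) = {xs})
    (xhat : ℕ → Ω → χ) (hxhat : IsInferredDecision Y c ξ γ y xhat) :
    0 < rateH f σ c ξ lamL y xs ∧
    Tendsto (fun t : ℕ => condLoss f dm P y xs (xhat t)) atTop (𝓝 0) ∧
    (rateH f σ c ξ lamL y xs : EReal) ≤
      liminf (fun t : ℕ => ((-(1 / (t : ℝ) ^ (1 / (1 + ξ))) : ℝ) : EReal) *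
        ENNReal.log (condLoss f dm P y xs (xhat t))) atTop := by
  have hσy : ∀ x, 0 < σ x y := fun x => hσ_pos x y (interior_subset hy)
  have hζ : 0 < zeta f σ y xs := zeta_pos hxs hσy
  obtain ⟨hs1, hs2⟩ := neg_lambertWLower_spec hζ.le
  set ζ := zeta f σ y xs with hζ_def
  set s := -lambertWLower (-Real.exp (-ζ - 1)) with hs
  have hs0 : 0 < s := by linarith
  set β := 1 / (1 + ξ) with hβ
  have hβ0 : 0 < β := by positivity
  have hC := ballConst_pos d hc
  set A := (ballConst d c * lamL / s) ^ β with hA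
  have hA0 : 0 < A := by positivity
  have hrate : rateH f σ c ξ lamL y xs = ζ * A := by
    rw [rateH, ← hζ_def, ← hs, ← hβ, hA, Real.div_rpow (by positivity) hs0.le,
      Real.rpow_neg hs0.le]
    ring
  have hpow : Tendsto (fun t : ℕ => (t : ℝ) ^ β) atTop atTop :=
    (tendsto_rpow_atTop hβ0).comp tendsto_natCast_atTop_atTop
  set level : ℕ → ℕ := fun t => ⌊A * (t : ℝ) ^ β⌋₊ with hlevel
  have hlevel_lim : Tendsto level atTop atTop :=
    tendsto_nat_floor_atTop.comp (hpow.const_mul_atTop hA0)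
  -- at this level, `t` stages give on average at least `s * level t` hits
  have hmean : ∀ t, 0 < level t →
      s * level t ≤ t * (lamL * ballConst d (radius d c ξ (level t))) := by
    intro t ht
    have hm : (0 : ℝ) < level t := by exact_mod_cast ht
    have h1 : (level t : ℝ) ≤ A * (t : ℝ) ^ β := Nat.floor_le (by positivity)
    have h2 : (level t : ℝ) ^ (1 + ξ) ≤ ballConst d c * lamL / s * t := by
      calc (level t : ℝ) ^ (1 + ξ) ≤ (A * (t : ℝ) ^ β) ^ (1 + ξ) := by gcongr
        _ = _ := by
          rw [hA, ← Real.mul_rpow (by positivity) (by positivity),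
            ← Real.rpow_mul (by positivity), hβ, one_div_mul_cancel (by positivity),
            Real.rpow_one]
    rw [ballConst_radius hd, Real.rpow_neg hm.le]
    rw [Real.rpow_add hm, Real.rpow_one] at h2
    have h3 : (0 : ℝ) < (level t : ℝ) ^ ξ := by positivity
    calc s * level t = s * (level t * (level t : ℝ) ^ ξ) * ((level t : ℝ) ^ ξ)⁻¹ := by
          field_simp
      _ ≤ s * (ballConst d c * lamL / s * t) * ((level t : ℝ) ^ ξ)⁻¹ := by gcongr
      _ = _ := by field_simp
  have hbound : ∀ H < ζ * A, ∀ᶠ t : ℕ in atTop,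
      condLoss f dm P y xs (xhat t) ≤ ENNReal.ofReal (Real.exp (-(H * (t : ℝ) ^ β))) := by
    intro H hH
    obtain ⟨z, hz1, hz2⟩ : ∃ z, max 0 (H / A) < z ∧ z < ζ :=
      exists_between (max_lt hζ ((div_lt_iff₀ hA0).2 hH))
    have hz0 : 0 < z := (le_max_left _ _).trans_lt hz1
    have hzA : H < z * A := (div_lt_iff₀ hA0).1 ((le_max_right _ _).trans_lt hz1)
    obtain ⟨ρ, hsep, hρ⟩ := (((eventually_lt_exponent hxs hσy L₁ L₂ hz2).filter_mono
      nhdsWithin_le_nhds).and (self_mem_nhdsWithin (s := Set.Ioi (0 : ℝ)))).exists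
    have hρ0 : (0 : ℝ) < ρ := hρ
    obtain ⟨ε, hε, hball⟩ := Metric.isOpen_iff.1 (isOpen_interior (s := Y)) y hy
    obtain ⟨N, hN⟩ := eventually_atTop.1
      ((tendsto_radius hd c hξ).eventually_le_const (lt_min hρ0 hε))
    filter_upwards [hlevel_lim.eventually_ge_atTop (max N 1),
      eventually_poly_mul_exp_floor_le (K := (∑ x, |dm (f x y) (f xs y)|) * Fintype.card χ)
        (by positivity) hβ0 hz0.le hzA] with t ht hpoly
    have htN : N ≤ level t := (le_max_left _ _).trans ht
    have ht1 : 0 < level t := (le_max_right _ _).trans ht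
    have hwrong := hγ.measure_ne_le hd ha hlamL ha_lower hf_lip hσ_pos hσ_lip hc hy hxhat hρ0.le
      hsep ht1 (fun m hm => (hN m (htN.trans hm)).trans (min_le_left _ _))
      ((Metric.ball_subset_ball ((hN _ htN).trans (min_le_right _ _))).trans hball) hs1
      (by rw [hs2]; exact hz2.le) (hmean t ht1)
    refine (condLoss_le f hdm P y xs (hxhat.measurable t)).trans
      ((mul_le_mul_right hwrong _).trans ?_)
    rw [← ENNReal.ofReal_mul (by positivity)]
    refine ENNReal.ofReal_le_ofReal (le_trans (le_of_eq ?_) hpoly)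
    ring
  rw [hrate]
  have hH0 : 0 < ζ * A := by positivity
  refine ⟨hH0, ?_, ?_⟩
  · have hlim : Tendsto (fun t : ℕ => ENNReal.ofReal (Real.exp (-(ζ * A / 2 * (t : ℝ) ^ β))))
        atTop (𝓝 0) := by
      rw [← ENNReal.ofReal_zero]
      refine ENNReal.tendsto_ofReal (Real.tendsto_exp_atBot.comp
        (tendsto_neg_atTop_atBot.comp (hpow.const_mul_atTop (by positivity))))
    exact tendsto_of_tendsto_of_tendsto_of_le_of_le' tendsto_const_nhds hlim
      (Eventually.of_forall fun _ => zero_le) (hbound _ (by linarith))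
  · refine le_of_forall_lt fun q hq => ?_
    obtain ⟨H, hqH, hH⟩ := EReal.lt_iff_exists_real_btwn.1 hq
    refine hqH.trans_le (le_liminf_of_le (by isBoundedDefault) ?_)
    filter_upwards [hbound H (EReal.coe_lt_coe_iff.1 hH), eventually_gt_atTop 0] with t ht ht0
    exact le_neg_inv_mul_log (by positivity) ht
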